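/- For $\mathbf q\in\mathbb R^m$ and a linear subspace $S\subseteq\mathbb R^m$ write $d_{\ell^1}(\mathbf q,S)=\min_{\mathbf v\in S}\|\mathbf q-\mathbf v\|_1$. There is an absolute constant $p>0$ such that the following holds. For every $\eta>1$ and every $\alpha$ with $0<\alpha<1-1/\eta$ there is a constant $C>0$, depending only on $\eta$ and $\alpha$, such that for all integers $n>r\ge 0$ there is a nonnegative integer $$d\le C\,(r\log n)^{1/\alpha}$$ with the following property. Let $D$ be any nonnegative integer, let $S_1,\dots,S_n$ be linear subspaces of dimension $r$ in $\mathbb R^D$, and let $\mathbf q\in\mathbb R^D$ be a query point such that, for all $i\in\{2,\dots,n\}$, $$d_{\ell^1}(\mathbf q,S_i)>0\quad\text{and}\quad d_{\ell^1}(\mathbf q,S_1)\le \frac{1}{\eta}\,d_{\ell^1}(\mathbf q,S_i).$$ If $\mathbf P\in\mathbb R^{d\times D}$ is a random matrix with independent standard Cauchy entries, then with probability at least $p$ the projected subspace $\mathbf P S_1$ is the unique nearest one to $\mathbf P\mathbf q$: $$d_{\ell^1}(\mathbf P\mathbf q,\mathbf P S_1)<d_{\ell^1}(\mathbf P\mathbf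 q,\mathbf P S_i)\quad\text{for all } i\in\{2,\dots,n\}.$$ -/

import Mathlib

open MeasureTheory ProbabilityTheory

/-- The `ℓ¹` distance `min_{v ∈ S} ‖q - v‖₁` of a point `q ∈ ℝᵐ` to a linear subspace `S`
(the infimum is over a nonempty set of nonnegative reals, and it is attained). -/
noncomputable def l1Dist {m : ℕ} (q : Fin m → ℝ) (S : Submodule ℝ (Fin m → ℝ)) : ℝ :=
  ⨅ v : S, ∑ j, |q j - (v : Fin m → ℝ) j|

/-- A random `d × D` matrix whose entries are independent standard Cauchy random variables. -/
structure IsIIDCauchy {Ω : Type*} [MeasurableSpace Ω] {d D : ℕ}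
    (P : Ω → Matrix (Fin d) (Fin D) ℝ) (μ : Measure Ω) : Prop where
  hasLaw : ∀ i j, HasLaw (fun ω => P ω i j) (cauchyMeasure 0 1) μ
  indep : iIndepFun (fun (ij : Fin d × Fin D) ω => P ω ij.1 ij.2) μ

/-! The Cauchy law is 1-stable: for fixed `x ≠ 0`, `P x` is distributed as `‖x‖₁` times a vector of
`d` independent standard Cauchy variables (`map_mulVec_cauchyMatrix`). The `ℓ¹` norm of that vector
has typical size `L = (2/π) d log d`, with very unequal tails. The upper tail is heavy: exceeding `κ
L` with `κ > 1` can only be given a small constant probability. The lower tail is light: for `β < 1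
- α`, falling below `β L` has probability at most `exp (-d ^ α)` for large `d`. Both follow from
Chernoff's bound for truncated variables.

This asymmetry is enough. The upper bound is needed for one vector only, `q - v₀` with `v₀ ∈ S₁`
nearly closest to `q`. The lower bound is needed on each space `S i + ℝ q` with `i ≠ 1`, of
dimension `r + 1`; it passes from a grid in an Auerbach basis to the whole space
(`exists_event_mul_l1Norm_le`). Nearest neighbours survive if `κ / η < β`, which is possible exactly
because `1 / η < 1 - α`. The union bound over the grids needs `d ^ α` to dominate a multiple of `r
log n`, which gives the dimension (`exists_dimension`). -/

/-! ### Characteristic function of the Cauchy law -/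

/-- The standard Cauchy measure has density `π⁻¹ (1 + x²)⁻¹`. -/
lemma integral_cauchyMeasure {E : Type*} [NormedAddCommGroup E] [NormedSpace ℝ E] (g : ℝ → E) :
    ∫ x, g x ∂(cauchyMeasure 0 1) = ∫ x, (Real.pi⁻¹ * (1 + x ^ 2)⁻¹) • g x := by
  rw [cauchyMeasure_of_scale_ne_zero 0 one_ne_zero]
  have h : cauchyPDF 0 1 = fun x => ENNReal.ofReal (Real.pi⁻¹ * (1 + x ^ 2)⁻¹) := by
    ext x
    simp [cauchyPDF_def, cauchyPDFReal_def, add_comm]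
  rw [h, integral_withDensity_eq_integral_toReal_smul (by fun_prop) (by simp)]
  refine integral_congr_ae (ae_of_all _ fun x => ?_)
  simp only
  rw [ENNReal.toReal_ofReal (by positivity)]

lemma integral_exp_neg_abs_mul_cexp (t : ℝ) :
    ∫ x : ℝ, Complex.exp (x * t * Complex.I) * (Real.exp (-|x|) : ℂ) = 2 * (1 + (t : ℂ) ^ 2)⁻¹ := by
  have h1 : ∀ x ∈ Set.Ioi (0 : ℝ), Complex.exp (x * t * Complex.I) * (Real.exp (-|x|) : ℂ) =
      Complex.exp ((-1 + t * Complex.I) * x) := by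
    intro x hx
    rw [abs_of_pos hx, Complex.ofReal_exp, ← Complex.exp_add]
    congr 1; push_cast; ring
  have h2 : ∀ x ∈ Set.Iic (0 : ℝ), Complex.exp (x * t * Complex.I) * (Real.exp (-|x|) : ℂ) =
      Complex.exp ((1 + t * Complex.I) * x) := by
    intro x hx
    rw [abs_of_nonpos hx, Complex.ofReal_exp, ← Complex.exp_add]
    congr 1; push_cast; ring
  have i1 : IntegrableOn (fun x : ℝ => Complex.exp (x * t * Complex.I) * (Real.exp (-|x|) : ℂ))
      (Set.Ioi 0) := by
    rw [integrableOn_congr_fun h1 measurableSet_Ioi]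
    exact integrableOn_exp_mul_complex_Ioi (by simp) 0
  have i2 : IntegrableOn (fun x : ℝ => Complex.exp (x * t * Complex.I) * (Real.exp (-|x|) : ℂ))
      (Set.Iic 0) := by
    rw [integrableOn_congr_fun h2 measurableSet_Iic]
    exact integrableOn_exp_mul_complex_Iic (by simp) 0
  rw [← intervalIntegral.integral_Iic_add_Ioi i2 i1, setIntegral_congr_fun measurableSet_Ioi h1,
    setIntegral_congr_fun measurableSet_Iic h2, integral_exp_mul_complex_Ioi (by simp),
    integral_exp_mul_complex_Iic (by simp)]
  have a1 : (1 + t * Complex.I : ℂ) ≠ 0 := fun h => by simpa using congrArg Complex.re h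
  have a2 : (-1 + t * Complex.I : ℂ) ≠ 0 := fun h => by simpa using congrArg Complex.re h
  have a3 : (1 + (t : ℂ) ^ 2) ≠ 0 := by
    have : (1 + (t : ℂ) ^ 2) = ((1 + t ^ 2 : ℝ) : ℂ) := by push_cast; ring
    rw [this]; exact_mod_cast (by positivity : (1 + t ^ 2 : ℝ) ≠ 0)
  simp only [Complex.ofReal_zero, mul_zero, Complex.exp_zero]
  field_simp
  ring_nf
  simp only [Complex.I_sq]
  ring

-- The transform of `exp (-|x|)` is proportional to the Cauchy density, so Fourier inversion returns
-- `exp (-|t|)`.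
open FourierTransform in
lemma charFun_cauchyMeasure (t : ℝ) :
    charFun (cauchyMeasure 0 1) t = (Real.exp (-|t|) : ℂ) := by
  have hint : Integrable (fun x : ℝ => (Real.exp (-|x|) : ℂ)) := by
    have h := integral_exp_neg_abs_mul_cexp 0
    simp only [Complex.ofReal_zero, mul_zero, zero_mul, Complex.exp_zero, one_mul] at h
    -- A non-integrable function has Bochner integral `0`, so the value `2` at frequency `0` already
    -- proves integrability.
    refine Integrable.of_integral_ne_zero ?_
    rw [h]; norm_num
  have hF : 𝓕 (fun x : ℝ => (Real.exp (-|x|) : ℂ)) =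
      fun w : ℝ => ((2 * (1 + (2 * Real.pi * w) ^ 2)⁻¹ : ℝ) : ℂ) := by
    ext w
    rw [Real.fourier_real_eq_integral_exp_smul]
    have := integral_exp_neg_abs_mul_cexp (-2 * Real.pi * w)
    calc _ = ∫ x : ℝ, Complex.exp (x * (-2 * Real.pi * w : ℝ) * Complex.I) *
          (Real.exp (-|x|) : ℂ) := by
          refine integral_congr_ae (ae_of_all _ fun x => ?_)
          simp only [smul_eq_mul]
          congr 2; push_cast; ring
      _ = _ := by rw [this]; push_cast; ring
  have hFi : Integrable (𝓕 (fun x : ℝ => (Real.exp (-|x|) : ℂ))) := by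
    rw [hF]
    refine Integrable.ofReal ?_
    refine Integrable.const_mul ?_ 2
    exact (integrable_inv_one_add_sq).comp_mul_left' (by positivity : 2 * Real.pi ≠ 0)
  have hcont : Continuous (fun x : ℝ => (Real.exp (-|x|) : ℂ)) := by fun_prop
  have hinv := congrFun (hcont.fourierInv_fourier_eq hint hFi) t
  rw [← hinv, Real.fourierInv_eq', hF, charFun_apply_real, integral_cauchyMeasure]
  -- The substitution `x ↦ 2πx` removes the `2π` in the exponent of the Fourier transform.
  have hs := Measure.integral_comp_mul_left (fun x : ℝ => ((Real.pi⁻¹ * (1 + x ^ 2)⁻¹ : ℝ) •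
    Complex.exp (t * x * Complex.I))) (2 * Real.pi)
  rw [abs_of_pos (by positivity), eq_comm, inv_smul_eq_iff₀ (by positivity)] at hs
  rw [hs, ← integral_smul]
  refine integral_congr_ae (ae_of_all _ fun x => ?_)
  simp only [smul_eq_mul, Complex.real_smul]
  have e : Complex.exp (t * ((2 * Real.pi * x : ℝ) : ℂ) * Complex.I) =
    Complex.exp ((2 * Real.pi * inner ℝ x t : ℝ) * Complex.I) := by
    congr 1; simp; ring
  rw [e]
  have hpi : (Real.pi : ℂ) ≠ 0 := by exact_mod_cast Real.pi_ne_zero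
  push_cast
  field_simp

/-! ### Truncated moments and tails of one Cauchy variable -/

/-- The absolute value of `x`, set to zero when it exceeds `T`. -/
noncomputable def truncAbs (T x : ℝ) : ℝ := (Set.Iic T).indicator id |x|

lemma truncAbs_of_le {T x : ℝ} (h : |x| ≤ T) : truncAbs T x = |x| := by
  simp [truncAbs, h]

lemma truncAbs_of_lt {T x : ℝ} (h : T < |x|) : truncAbs T x = 0 := by
  simp [truncAbs, h]

lemma truncAbs_nonneg (T x : ℝ) : 0 ≤ truncAbs T x := by
  rcases le_or_gt |x| T with h | h
  · rw [truncAbs_of_le h]; positivity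
  · rw [truncAbs_of_lt h]

lemma truncAbs_le_abs (T x : ℝ) : truncAbs T x ≤ |x| := by
  rcases le_or_gt |x| T with h | h
  · rw [truncAbs_of_le h]
  · rw [truncAbs_of_lt h]; positivity

lemma truncAbs_le {T : ℝ} (hT : 0 ≤ T) (x : ℝ) : truncAbs T x ≤ T := by
  rcases le_or_gt |x| T with h | h
  · rwa [truncAbs_of_le h]
  · rwa [truncAbs_of_lt h]

@[fun_prop]
lemma measurable_truncAbs (T : ℝ) : Measurable (truncAbs T) := by
  unfold truncAbs
  exact (measurable_id.indicator measurableSet_Iic).comp measurable_norm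

lemma integral_cauchyMeasure_comp_abs (f : ℝ → ℝ) :
    ∫ x, f |x| ∂(cauchyMeasure 0 1) =
      2 / Real.pi * ∫ y in Set.Ioi 0, (1 + y ^ 2)⁻¹ * f y := by
  rw [integral_cauchyMeasure]
  have := integral_comp_abs (f := fun y : ℝ => (Real.pi⁻¹ * (1 + y ^ 2)⁻¹) • f y)
  simp only [sq_abs] at this
  rw [this]
  simp only [smul_eq_mul, mul_assoc, integral_const_mul]
  ring

lemma integral_cauchyMeasure_indicator_abs {T : ℝ} (hT : 0 ≤ T) (g : ℝ → ℝ) :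
    ∫ x, (Set.Iic T).indicator g |x| ∂(cauchyMeasure 0 1) =
      2 / Real.pi * ∫ y in 0..T, (1 + y ^ 2)⁻¹ * g y := by
  rw [integral_cauchyMeasure_comp_abs, intervalIntegral.integral_of_le hT]
  congr 1
  rw [← Set.Ioi_inter_Iic, Set.inter_comm, ← Measure.restrict_restrict measurableSet_Iic,
    ← integral_indicator measurableSet_Iic]
  congr 1
  ext y
  by_cases h : y ≤ T <;> simp [h]

/-- The truncated mean grows like `(2/π) log T`; every later constant comes from this rate. -/
lemma integral_truncAbs {T : ℝ} (hT : 0 ≤ T) :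
    ∫ x, truncAbs T x ∂(cauchyMeasure 0 1) = Real.log (1 + T ^ 2) / Real.pi := by
  unfold truncAbs
  rw [integral_cauchyMeasure_indicator_abs hT]
  have : ∫ y in (0 : ℝ)..T, (1 + y ^ 2)⁻¹ * id y =
      Real.log (1 + T ^ 2) / 2 - Real.log (1 + 0 ^ 2) / 2 := by
    refine intervalIntegral.integral_eq_sub_of_hasDerivAt (f := fun y => Real.log (1 + y ^ 2) / 2)
      (fun y _ => ?_) ?_
    · have h1 : HasDerivAt (fun y : ℝ => 1 + y ^ 2) (2 * y) y := by
        simpa using (hasDerivAt_pow 2 y).const_add 1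
      refine ((h1.log (by positivity)).div_const 2).congr_deriv ?_
      rw [id]
      field_simp
    · refine Continuous.intervalIntegrable ?_ _ _
      refine Continuous.mul (Continuous.inv₀ (by fun_prop) fun y => by positivity) continuous_id
  rw [this]
  simp

lemma integrable_of_truncAbs_comp {T : ℝ} (hT : 0 ≤ T) {g : ℝ → ℝ} (hg : Continuous g) :
    Integrable (fun x => g (truncAbs T x)) (cauchyMeasure 0 1) := by
  obtain ⟨C, hC⟩ := (isCompact_Icc (a := (0 : ℝ)) (b := T)).exists_bound_of_continuousOn
    hg.continuousOn
  refine Integrable.of_bound (C := C) ?_ (ae_of_all _ fun x => ?_)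
  · exact (hg.measurable.comp (measurable_truncAbs T)).aestronglyMeasurable
  · exact hC _ ⟨truncAbs_nonneg T x, truncAbs_le hT x⟩

/-- The density cancels the square, leaving an integrand at most `1` on `[0, T]`; the trivial bound
`T ^ 2` would be too weak for Chernoff. -/
lemma integral_truncAbs_sq_le {T : ℝ} (hT : 0 ≤ T) :
    ∫ x, truncAbs T x ^ 2 ∂(cauchyMeasure 0 1) ≤ T := by
  have h : ∀ x, truncAbs T x ^ 2 = (Set.Iic T).indicator (fun y => y ^ 2) |x| := by
    intro x
    by_cases h : |x| ≤ T <;> simp [truncAbs, h]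
  simp_rw [h]
  rw [integral_cauchyMeasure_indicator_abs hT]
  have h1 : ∫ y in (0 : ℝ)..T, (1 + y ^ 2)⁻¹ * y ^ 2 ≤ ∫ y in (0 : ℝ)..T, (1 : ℝ) := by
    refine intervalIntegral.integral_mono_on hT ?_ (by simp) fun y _ => ?_
    · refine Continuous.intervalIntegrable ?_ _ _
      refine Continuous.mul (Continuous.inv₀ (by fun_prop) fun y => by positivity) (by fun_prop)
    · rw [inv_mul_le_iff₀ (by positivity)]; linarith
  have h2 : 2 / Real.pi ≤ 1 := by
    rw [div_le_one Real.pi_pos]; exact Real.two_le_pi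
  have h3 : 0 ≤ 2 / Real.pi := by positivity
  simp at h1
  nlinarith

lemma arctan_le_self {x : ℝ} (hx : 0 ≤ x) : Real.arctan x ≤ x := by
  conv_rhs => rw [← Real.tan_arctan x]
  exact Real.le_tan (Real.arctan_nonneg.2 hx) (Real.arctan_lt_pi_div_two x)

lemma cauchyMeasure_tail_le {T : ℝ} (hT : 0 < T) :
    (cauchyMeasure 0 1).real {x | T < |x|} ≤ 1 / T := by
  have hm : MeasurableSet {x : ℝ | T < |x|} := measurableSet_lt measurable_const measurable_norm
  rw [← integral_indicator_one hm]
  have h : ∀ x : ℝ, {x : ℝ | T < |x|}.indicator (1 : ℝ → ℝ) x =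
      (Set.Ioi T).indicator (1 : ℝ → ℝ) |x| := by
    intro x
    by_cases h : T < |x| <;> simp [h]
  simp_rw [h]
  rw [integral_cauchyMeasure_comp_abs]
  have h1 : ∫ y in Set.Ioi (0 : ℝ), (1 + y ^ 2)⁻¹ * (Set.Ioi T).indicator (1 : ℝ → ℝ) y =
      ∫ y in Set.Ioi T, (1 + y ^ 2)⁻¹ := by
    have : Set.Ioi T ∩ Set.Ioi 0 = Set.Ioi T :=
      Set.inter_eq_left.2 fun y hy => hT.trans hy
    have h2 : ∫ y in Set.Ioi T, (1 + y ^ 2)⁻¹ =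
        ∫ y in Set.Ioi (0 : ℝ), (Set.Ioi T).indicator (fun y => (1 + y ^ 2)⁻¹) y := by
      rw [integral_indicator measurableSet_Ioi, Measure.restrict_restrict measurableSet_Ioi, this]
    rw [h2]
    refine integral_congr_ae (ae_of_all _ fun y => ?_)
    by_cases h : T < y <;> simp [h]
  rw [h1, integral_Ioi_inv_one_add_sq, ← Real.arctan_inv_of_pos hT]
  have h2 : Real.arctan T⁻¹ ≤ T⁻¹ := arctan_le_self (by positivity)
  have h3 : 2 / Real.pi ≤ 1 := by
    rw [div_le_one Real.pi_pos]; exact Real.two_le_pi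
  have h4 : 0 ≤ 2 / Real.pi := by positivity
  have h5 : 0 ≤ T⁻¹ := by positivity
  rw [one_div]
  calc _ ≤ 2 / Real.pi * T⁻¹ := by gcongr
    _ ≤ 1 * T⁻¹ := by gcongr
    _ = _ := one_mul _

/-- Apply `exp z ≤ 1 + z + z ^ 2` for `|z| ≤ 1`; by the second moment bound the quadratic term costs
only `1 / T`. The sign `σ` covers both tails. -/
lemma integral_exp_truncAbs_le {T : ℝ} (hT : 0 < T) {σ : ℝ} (hσ : |σ| = 1) :
    ∫ x, Real.exp (σ * truncAbs T x / T) ∂(cauchyMeasure 0 1) ≤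
      Real.exp ((σ * (Real.log (1 + T ^ 2) / Real.pi) + 1) / T) := by
  have hpt : ∀ x, Real.exp (σ * truncAbs T x / T) ≤
      1 + (σ / T) * truncAbs T x + (T ^ 2)⁻¹ * truncAbs T x ^ 2 := by
    intro x
    have hσ2 : σ ^ 2 = 1 := by rw [← sq_abs, hσ, one_pow]
    have h1 : |σ * truncAbs T x / T| ≤ 1 := by
      rw [abs_div, abs_mul, hσ, one_mul, abs_of_pos hT, abs_of_nonneg (truncAbs_nonneg T x),
        div_le_one hT]
      exact truncAbs_le hT.le x
    have h2 := (abs_le.1 (Real.abs_exp_sub_one_sub_id_le h1)).2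
    have h3 : (σ * truncAbs T x / T) ^ 2 = (T ^ 2)⁻¹ * truncAbs T x ^ 2 := by
      rw [div_pow, mul_pow, hσ2]; field_simp
    rw [h3] at h2
    have h4 : σ * truncAbs T x / T = (σ / T) * truncAbs T x := by ring
    rw [h4] at h2 ⊢
    linarith
  have i1 := integrable_of_truncAbs_comp hT.le (g := fun y => y) continuous_id
  have i2 := integrable_of_truncAbs_comp hT.le (g := fun y => y ^ 2) (by fun_prop)
  calc _ ≤ ∫ x, (1 + (σ / T) * truncAbs T x + (T ^ 2)⁻¹ * truncAbs T x ^ 2)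
          ∂(cauchyMeasure 0 1) := by
        refine integral_mono (integrable_of_truncAbs_comp hT.le
          (g := fun y => Real.exp (σ * y / T)) (by fun_prop)) ?_ hpt
        exact ((integrable_const 1).add (i1.const_mul _)).add (i2.const_mul _)
    _ = 1 + (σ / T) * (Real.log (1 + T ^ 2) / Real.pi) +
          (T ^ 2)⁻¹ * ∫ x, truncAbs T x ^ 2 ∂(cauchyMeasure 0 1) := by
        rw [integral_add (by fun_prop) (i2.const_mul _), integral_add (integrable_const 1) (i1.const_mul _), integral_const_mul,
          integral_const_mul, integral_truncAbs hT.le]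
        simp
    _ ≤ 1 + (σ / T) * (Real.log (1 + T ^ 2) / Real.pi) + (T ^ 2)⁻¹ * T := by
        gcongr; exact integral_truncAbs_sq_le hT.le
    _ = (σ * (Real.log (1 + T ^ 2) / Real.pi) + 1) / T + 1 := by field_simp; ring
    _ ≤ _ := Real.add_one_le_exp _

/-! ### Stability and tails of sums of Cauchy variables -/

/-- The characteristic functions `exp (-|t x k|)` multiply to `exp (-|t| ∑ |x k|)`. -/
lemma map_sum_mul_pi_cauchyMeasure {ι : Type*} [Fintype ι] (x : ι → ℝ) :
    (Measure.pi fun _ : ι => cauchyMeasure 0 1).map (fun p => ∑ k, p k * x k) =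
      (cauchyMeasure 0 1).map (fun y => (∑ k, |x k|) * y) := by
  have : IsProbabilityMeasure
      ((Measure.pi fun _ : ι => cauchyMeasure 0 1).map (fun p => ∑ k, p k * x k)) :=
    Measure.isProbabilityMeasure_map (Measurable.aemeasurable (by fun_prop))
  have : IsProbabilityMeasure ((cauchyMeasure 0 1).map (fun y => (∑ k, |x k|) * y)) :=
    Measure.isProbabilityMeasure_map (by fun_prop)
  have hX : iIndepFun (fun k (p : ι → ℝ) => p k * x k) (Measure.pi fun _ : ι => cauchyMeasure 0 1) :=
    iIndepFun_pi (X := fun k y => y * x k) (fun k => by fun_prop)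
  refine Measure.ext_of_charFun ?_
  rw [hX.charFun_map_fun_sum_eq_prod (fun k => Measurable.aemeasurable (by fun_prop))]
  ext t
  rw [Finset.prod_apply, charFun_map_mul, charFun_cauchyMeasure, abs_mul,
    abs_of_nonneg (Finset.sum_nonneg fun _ _ => abs_nonneg _), Finset.sum_mul,
    ← Finset.sum_neg_distrib, Real.exp_sum, Complex.ofReal_prod]
  refine Finset.prod_congr rfl fun k _ => ?_
  have h1 : (fun p : ι → ℝ => p k * x k) = (fun y => x k * y) ∘ (fun p => p k) := by
    ext p; simp [mul_comm]
  rw [h1, ← Measure.map_map (by fun_prop) (by fun_prop),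
    (measurePreserving_eval (fun _ : ι => cauchyMeasure 0 1) k).map_eq, charFun_map_mul,
    charFun_cauchyMeasure, abs_mul]

/-- Chernoff's bound for a sum of independent copies of a bounded random variable. -/
lemma measureReal_pi_le_exp {ι E : Type*} [Fintype ι] [MeasurableSpace E] (ν : Measure E)
    [IsProbabilityMeasure ν] {f : E → ℝ} (hf : Integrable (fun x => Real.exp (f x)) ν)
    {a : ℝ} (ha : ∫ x, Real.exp (f x) ∂ν ≤ Real.exp a) (s : ℝ) :
    (Measure.pi fun _ : ι => ν).real {ω | s ≤ ∑ j, f (ω j)} ≤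
      Real.exp (Fintype.card ι * a - s) := by
  have hprod : ∀ ω : ι → E, Real.exp (∑ j, f (ω j)) = ∏ j, Real.exp (f (ω j)) := fun ω =>
    Real.exp_sum _ _
  have hint : Integrable (fun ω : ι → E => Real.exp (1 * ∑ j, f (ω j)))
      (Measure.pi fun _ : ι => ν) := by
    simp only [one_mul, hprod]
    exact Integrable.fintype_prod (f := fun _ x => Real.exp (f x)) fun _ => hf
  have h := measure_ge_le_exp_mul_mgf (X := fun ω : ι → E => ∑ j, f (ω j)) s zero_le_one hint
  refine h.trans ?_
  rw [mgf]
  simp only [one_mul, hprod]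
  rw [integral_fintype_prod_eq_pow (f := fun x => Real.exp (f x)), sub_eq_add_neg, Real.exp_add,
    mul_comm, neg_mul, one_mul, Real.exp_nat_mul]
  gcongr

lemma measureReal_pi_cauchyMeasure_tail_le {ι : Type*} [Fintype ι] (j : ι) {T : ℝ} (hT : 0 < T) :
    (Measure.pi fun _ : ι => cauchyMeasure 0 1).real {y | T < |y j|} ≤ 1 / T := by
  have h := (measurePreserving_eval (fun _ : ι => cauchyMeasure 0 1) j).measureReal_preimage
    (s := {x : ℝ | T < |x|}) (measurableSet_lt measurable_const measurable_norm).nullMeasurableSet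
  exact h.trans_le (cauchyMeasure_tail_le hT)

/-- Lower tail of the `ℓ¹` norm of a vector of independent standard Cauchy variables. -/
lemma measureReal_pi_cauchyMeasure_sum_abs_le {ι : Type*} [Fintype ι] {M : ℝ} (hM : 0 < M)
    (s : ℝ) :
    (Measure.pi fun _ : ι => cauchyMeasure 0 1).real {y | ∑ j, |y j| ≤ s} ≤
      Real.exp (Fintype.card ι * ((-(Real.log (1 + M ^ 2) / Real.pi) + 1) / M) + s / M) := by
  have h := measureReal_pi_le_exp (ι := ι) (cauchyMeasure 0 1)
    (f := fun x => -1 * truncAbs M x / M)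
    (integrable_of_truncAbs_comp hM.le (g := fun y => Real.exp (-1 * y / M)) (by fun_prop))
    (integral_exp_truncAbs_le hM (by simp)) (-(s / M))
  rw [sub_neg_eq_add, neg_one_mul] at h
  refine le_trans (measureReal_mono fun y hy => ?_) h
  have hy : ∑ j, |y j| ≤ s := hy
  have h1 : ∑ j, truncAbs M (y j) ≤ s :=
    (Finset.sum_le_sum fun j _ => truncAbs_le_abs M (y j)).trans hy
  change -(s / M) ≤ ∑ j, -1 * truncAbs M (y j) / M
  rw [← Finset.sum_div, ← Finset.mul_sum, neg_one_mul, neg_div, neg_le_neg_iff]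
  gcongr

/-- Upper tail of the `ℓ¹` norm of a vector of independent standard Cauchy variables. -/
lemma measureReal_pi_cauchyMeasure_lt_sum_abs {ι : Type*} [Fintype ι] {T : ℝ} (hT : 0 < T)
    (s : ℝ) :
    (Measure.pi fun _ : ι => cauchyMeasure 0 1).real {y | s < ∑ j, |y j|} ≤
      Fintype.card ι / T +
        Real.exp (Fintype.card ι * ((Real.log (1 + T ^ 2) / Real.pi + 1) / T) - s / T) := by
  have h := measureReal_pi_le_exp (ι := ι) (cauchyMeasure 0 1)
    (f := fun x => 1 * truncAbs T x / T)
    (integrable_of_truncAbs_comp hT.le (g := fun y => Real.exp (1 * y / T)) (by fun_prop))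
    (integral_exp_truncAbs_le hT (by simp)) (s / T)
  rw [one_mul] at h
  -- Either some coordinate exceeds `T`, which costs `1 / T` each, or truncation changes nothing and
  -- Chernoff applies.
  have hsub : {y : ι → ℝ | s < ∑ j, |y j|} ⊆
      (⋃ j, {y | T < |y j|}) ∪ {y | s / T ≤ ∑ j, 1 * truncAbs T (y j) / T} := by
    intro y hy
    have hy : s < ∑ j, |y j| := hy
    by_cases hj : ∃ j, T < |y j|
    · exact Or.inl (Set.mem_iUnion.2 hj)
    · push Not at hj
      right
      change s / T ≤ ∑ j, 1 * truncAbs T (y j) / T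
      rw [← Finset.sum_div, ← Finset.mul_sum, one_mul,
        Finset.sum_congr rfl fun j _ => truncAbs_of_le (hj j)]
      gcongr
  refine (measureReal_mono hsub).trans ((measureReal_union_le _ _).trans (add_le_add ?_ h))
  refine (measureReal_iUnion_fintype_le _).trans ?_
  refine (Finset.sum_le_sum fun j _ => measureReal_pi_cauchyMeasure_tail_le j hT).trans ?_
  simp [div_eq_mul_inv]

/-- Some coordinate must exceed `s / d`. This serves for the images of basis vectors, where only a
polynomial bound is needed. -/
lemma measureReal_pi_cauchyMeasure_lt_sum_abs_crude {d : ℕ} {s : ℝ} (hs : 0 < s) :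
    (Measure.pi fun _ : Fin d => cauchyMeasure 0 1).real {y | s < ∑ j, |y j|} ≤ d ^ 2 / s := by
  rcases Nat.eq_zero_or_pos d with rfl | hd
  · have : {y : Fin 0 → ℝ | s < ∑ j, |y j|} = ∅ := by
      ext y; simp [hs.le]
    rw [this]; simp
  have hd' : (0 : ℝ) < d := by exact_mod_cast hd
  have hsub : {y : Fin d → ℝ | s < ∑ j, |y j|} ⊆ ⋃ j, {y | s / d < |y j|} := by
    intro y hy
    have hy : s < ∑ j, |y j| := hy
    rw [Set.mem_iUnion]
    by_contra! hc
    have : ∑ j, |y j| ≤ ∑ _j : Fin d, s / d := Finset.sum_le_sum fun j _ => not_lt.1 (hc j)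
    rw [Finset.sum_const, Finset.card_univ, Fintype.card_fin, nsmul_eq_mul,
      mul_div_cancel₀ _ hd'.ne'] at this
    linarith
  refine (measureReal_mono hsub).trans ((measureReal_iUnion_fintype_le _).trans ?_)
  refine (Finset.sum_le_sum fun j _ =>
    measureReal_pi_cauchyMeasure_tail_le j (div_pos hs hd')).trans ?_
  simp
  apply le_of_eq
  field_simp

/-! ### The `ℓ¹` norm and Cauchy matrices -/

/-- The `ℓ¹` norm on `ℝᵐ`. -/
noncomputable def l1Norm {m : ℕ} (x : Fin m → ℝ) : ℝ := ∑ j, |x j|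

lemma l1Norm_nonneg {m : ℕ} (x : Fin m → ℝ) : 0 ≤ l1Norm x :=
  Finset.sum_nonneg fun _ _ => abs_nonneg _

lemma l1Norm_zero {m : ℕ} : l1Norm (0 : Fin m → ℝ) = 0 := by simp [l1Norm]

lemma l1Norm_eq_zero {m : ℕ} {x : Fin m → ℝ} : l1Norm x = 0 ↔ x = 0 := by
  rw [l1Norm, Finset.sum_eq_zero_iff_of_nonneg fun _ _ => abs_nonneg _]
  simp [funext_iff]

lemma l1Norm_pos {m : ℕ} {x : Fin m → ℝ} (hx : x ≠ 0) : 0 < l1Norm x :=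
  (l1Norm_nonneg x).lt_of_ne' fun h => hx (l1Norm_eq_zero.1 h)

lemma l1Norm_add_le {m : ℕ} (x y : Fin m → ℝ) : l1Norm (x + y) ≤ l1Norm x + l1Norm y := by
  rw [l1Norm, l1Norm, l1Norm, ← Finset.sum_add_distrib]
  exact Finset.sum_le_sum fun j _ => abs_add_le _ _

lemma l1Norm_smul {m : ℕ} (c : ℝ) (x : Fin m → ℝ) : l1Norm (c • x) = |c| * l1Norm x := by
  simp [l1Norm, abs_mul, Finset.mul_sum]

lemma l1Norm_sum_le {m : ℕ} {ι : Type*} (s : Finset ι) (f : ι → Fin m → ℝ) :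
    l1Norm (∑ i ∈ s, f i) ≤ ∑ i ∈ s, l1Norm (f i) :=
  Finset.le_sum_of_subadditive l1Norm l1Norm_zero.le l1Norm_add_le s f

@[fun_prop]
lemma continuous_l1Norm {m : ℕ} : Continuous (l1Norm (m := m)) := by
  unfold l1Norm; fun_prop

/-- The law of a `d × D` matrix with independent standard Cauchy entries. -/
noncomputable def cauchyMatrix (d D : ℕ) : Measure (Fin d → Fin D → ℝ) :=
  Measure.pi fun _ => Measure.pi fun _ => cauchyMeasure 0 1

instance (d D : ℕ) : IsProbabilityMeasure (cauchyMatrix d D) := by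
  unfold cauchyMatrix; infer_instance

lemma map_mulVec_cauchyMatrix {d D : ℕ} {x : Fin D → ℝ} (hx : x ≠ 0) :
    (cauchyMatrix d D).map (fun A j => (l1Norm x)⁻¹ * ∑ k, A j k * x k) =
      Measure.pi fun _ => cauchyMeasure 0 1 := by
  have hrow : (Measure.pi fun _ : Fin D => cauchyMeasure 0 1).map
      (fun p => (l1Norm x)⁻¹ * ∑ k, p k * x k) = cauchyMeasure 0 1 := by
    have h1 : (fun p : Fin D → ℝ => (l1Norm x)⁻¹ * ∑ k, p k * x k) =
        (fun y => (l1Norm x)⁻¹ * y) ∘ (fun p => ∑ k, p k * x k) := rfl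
    rw [h1, ← Measure.map_map (by fun_prop) (by fun_prop), map_sum_mul_pi_cauchyMeasure,
      Measure.map_map (by fun_prop) (by fun_prop)]
    have h2 : ((fun y => (l1Norm x)⁻¹ * y) ∘ fun y => (∑ k, |x k|) * y) = id := by
      ext y
      simp only [Function.comp, id]
      rw [← mul_assoc, ← l1Norm, inv_mul_cancel₀ (l1Norm_pos hx).ne', one_mul]
    rw [h2, Measure.map_id]
  have : IsProbabilityMeasure ((Measure.pi fun _ : Fin D => cauchyMeasure 0 1).map
      (fun p => (l1Norm x)⁻¹ * ∑ k, p k * x k)) := by rw [hrow]; infer_instance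
  have h := Measure.pi_map_pi (ι := Fin d) (μ := fun _ => Measure.pi fun _ : Fin D => cauchyMeasure 0 1)
    (f := fun _ (p : Fin D → ℝ) => (l1Norm x)⁻¹ * ∑ k, p k * x k)
    (fun _ => Measurable.aemeasurable (by fun_prop))
  rw [cauchyMatrix]
  rw [hrow] at h
  exact h

lemma cauchyMatrix_real_l1Norm_mulVec_mem {d D : ℕ} {x : Fin D → ℝ} (hx : x ≠ 0) {s : Set ℝ}
    (hs : MeasurableSet s) :
    (cauchyMatrix d D).real {A | (l1Norm x)⁻¹ * l1Norm ((Matrix.of A).mulVec x) ∈ s} =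
      (Measure.pi fun _ : Fin d => cauchyMeasure 0 1).real {y | ∑ j, |y j| ∈ s} := by
  rw [← map_mulVec_cauchyMatrix (D := D) hx, map_measureReal_apply (by fun_prop)]
  · congr 1
    ext A
    have : ∑ j, |(l1Norm x)⁻¹ * ∑ k, A j k * x k| = (l1Norm x)⁻¹ * l1Norm ((Matrix.of A).mulVec x) := by
      simp_rw [abs_mul, abs_of_pos (inv_pos.2 (l1Norm_pos hx))]
      rw [← Finset.mul_sum]
      rfl
    simp only [Set.mem_preimage, Set.mem_ofPred_eq]
    rw [this]
  · exact (by fun_prop : Measurable fun y : Fin d → ℝ => ∑ j, |y j|) hs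

lemma cauchyMatrix_lower_tail {d D : ℕ} {x : Fin D → ℝ} (hx : x ≠ 0) {M : ℝ} (hM : 0 < M) (s : ℝ) :
    (cauchyMatrix d D).real {A | l1Norm ((Matrix.of A).mulVec x) ≤ s * l1Norm x} ≤
      Real.exp (d * ((-(Real.log (1 + M ^ 2) / Real.pi) + 1) / M) + s / M) := by
  have h := measureReal_pi_cauchyMeasure_sum_abs_le (ι := Fin d) hM s
  rw [Fintype.card_fin] at h
  refine le_trans (le_of_eq ?_) h
  refine Eq.trans ?_ (cauchyMatrix_real_l1Norm_mulVec_mem (D := D) hx (measurableSet_Iic (a := s)))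
  congr 1
  ext A
  simp only [Set.mem_ofPred_eq, Set.mem_Iic]
  rw [inv_mul_le_iff₀ (l1Norm_pos hx), mul_comm s]

lemma cauchyMatrix_real_lt_l1Norm_mulVec {d D : ℕ} {x : Fin D → ℝ} (hx : x ≠ 0) (s : ℝ) :
    (cauchyMatrix d D).real {A | s * l1Norm x < l1Norm ((Matrix.of A).mulVec x)} =
      (Measure.pi fun _ : Fin d => cauchyMeasure 0 1).real {y | s < ∑ j, |y j|} := by
  refine Eq.trans ?_ (cauchyMatrix_real_l1Norm_mulVec_mem (D := D) hx (measurableSet_Ioi (a := s)))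
  congr 1
  ext A
  change _ ↔ s < _
  rw [Set.mem_ofPred_eq]
  rw [lt_inv_mul_iff₀ (l1Norm_pos hx), mul_comm s]

lemma cauchyMatrix_upper_tail {d D : ℕ} (x : Fin D → ℝ) {T : ℝ} (hT : 0 < T) (s : ℝ) :
    (cauchyMatrix d D).real {A | s * l1Norm x < l1Norm ((Matrix.of A).mulVec x)} ≤
      d / T + Real.exp (d * ((Real.log (1 + T ^ 2) / Real.pi + 1) / T) - s / T) := by
  rcases eq_or_ne x 0 with rfl | hx
  · simp only [l1Norm_zero, Matrix.mulVec_zero, mul_zero, lt_irrefl, Set.ofPred_false,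
      measureReal_empty]
    positivity
  · rw [cauchyMatrix_real_lt_l1Norm_mulVec hx]
    simpa using measureReal_pi_cauchyMeasure_lt_sum_abs (ι := Fin d) hT s

lemma cauchyMatrix_upper_tail_crude {d D : ℕ} (x : Fin D → ℝ) {s : ℝ} (hs : 0 < s) :
    (cauchyMatrix d D).real {A | s * l1Norm x < l1Norm ((Matrix.of A).mulVec x)} ≤ d ^ 2 / s := by
  rcases eq_or_ne x 0 with rfl | hx
  · simp only [l1Norm_zero, Matrix.mulVec_zero, mul_zero, lt_irrefl, Set.ofPred_false,
      measureReal_empty]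
    positivity
  · rw [cauchyMatrix_real_lt_l1Norm_mulVec hx]
    exact measureReal_pi_cauchyMeasure_lt_sum_abs_crude hs

/-- A random matrix with independent standard Cauchy entries has law `cauchyMatrix`. -/
lemma IsIIDCauchy.hasLaw_cauchyMatrix {Ω : Type*} [MeasurableSpace Ω] {μ : Measure Ω}
    [IsProbabilityMeasure μ] {d D : ℕ} {P : Ω → Matrix (Fin d) (Fin D) ℝ} (hP : IsIIDCauchy P μ) :
    HasLaw (fun ω i j => P ω i j) (cauchyMatrix d D) μ := by
  have hae : ∀ i j, AEMeasurable (fun ω => P ω i j) μ := fun i j => (hP.hasLaw i j).aemeasurable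
  refine ⟨aemeasurable_pi_iff.2 fun i => aemeasurable_pi_iff.2 fun j => hae i j, ?_⟩
  have h1 := hP.indep.map_fun_eq_pi_map (fun ij : Fin d × Fin D => hae ij.1 ij.2)
  have hlaw : ∀ i j, (cauchyMatrix d D).map (fun A => A i j) = cauchyMeasure 0 1 := by
    intro i j
    have := ((measurePreserving_eval (fun _ : Fin D => cauchyMeasure 0 1) j).comp
      (measurePreserving_eval (fun _ : Fin d => Measure.pi fun _ : Fin D => cauchyMeasure 0 1) i))
    exact this.map_eq
  have hind : iIndepFun (fun (p : Fin d × Fin D) (A : Fin d → Fin D → ℝ) => A p.1 p.2)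
      (cauchyMatrix d D) := by
    refine iIndepFun_uncurry' (X := fun i j (A : Fin d → Fin D → ℝ) => A i j) (by fun_prop) ?_ ?_
    · exact iIndepFun_pi (X := fun _ (p : Fin D → ℝ) => p) (fun _ => aemeasurable_id)
    · intro i
      have he := (measurePreserving_eval
        (fun _ : Fin d => Measure.pi fun _ : Fin D => cauchyMeasure 0 1) i).map_eq
      rw [iIndepFun_iff_map_fun_eq_pi_map (fun _ => Measurable.aemeasurable (by fun_prop))]
      simp only [hlaw]
      exact he
  have h2 := hind.map_fun_eq_pi_map (fun _ => Measurable.aemeasurable (by fun_prop))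
  simp only [hlaw] at h2
  simp only [(hP.hasLaw _ _).map_eq] at h1
  -- Both families of entries have the same product law over `Fin d × Fin D`; currying turns this
  -- into equality of the matrix laws.
  have h3 := congrArg (Measure.map (MeasurableEquiv.curry (Fin d) (Fin D) ℝ)) (h1.trans h2.symm)
  rw [AEMeasurable.map_map_of_aemeasurable (by fun_prop)
      (aemeasurable_pi_iff.2 fun ij : Fin d × Fin D => hae ij.1 ij.2),
    Measure.map_map (by fun_prop) (by fun_prop)] at h3
  exact h3.trans Measure.map_id

/-! ### Lower bounds on subspaces by discretisation -/

/-- Auerbach's lemma for subspaces of `ℓ¹`. -/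
lemma exists_auerbach_basis {D : ℕ} (W : Submodule ℝ (Fin D → ℝ)) {k : ℕ}
    (hk : Module.finrank ℝ W = k) :
    ∃ b : Module.Basis (Fin k) ℝ W, (∀ i, l1Norm (b i : Fin D → ℝ) ≤ 1) ∧
      ∀ (w : W) i, |b.repr w i| ≤ l1Norm (w : Fin D → ℝ) := by
  obtain ⟨e⟩ : Nonempty (Module.Basis (Fin k) ℝ W) := ⟨Module.finBasisOfFinrankEq ℝ W hk⟩
  set K : Set W := {w | l1Norm (w : Fin D → ℝ) ≤ 1} with hK
  have hKc : IsCompact K := by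
    refine Metric.isCompact_of_isClosed_isBounded ?_ ?_
    · exact isClosed_le (by fun_prop) continuous_const
    · refine (Metric.isBounded_closedBall (x := (0 : W)) (r := 1)).subset fun w hw => ?_
      rw [mem_closedBall_zero_iff, Submodule.coe_norm, pi_norm_le_iff_of_nonneg zero_le_one]
      intro j
      exact (Finset.single_le_sum (f := fun j => |(w : Fin D → ℝ) j|) (fun _ _ => abs_nonneg _)
        (Finset.mem_univ j)).trans hw
  have hKpi : IsCompact (Set.univ.pi fun _ : Fin k => K) := isCompact_univ_pi fun _ => hKc
  have hdet : Continuous fun v : Fin k → W => |e.det v| := by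
    refine continuous_abs.comp ?_
    change Continuous fun v : Fin k → W => (e.toMatrix v).det
    refine Continuous.matrix_det ?_
    refine continuous_matrix fun i j => ?_
    simp only [Module.Basis.toMatrix_apply]
    exact ((e.coord i).continuous_of_finiteDimensional).comp (continuous_apply j)
  -- The Auerbach basis maximises the volume `|det|` among `k`-tuples in the unit ball.
  obtain ⟨v, hv, hmax⟩ := hKpi.exists_isMaxOn
    ⟨0, fun _ _ => by simp [hK, l1Norm_zero]⟩ hdet.continuousOn
  have hvK : ∀ i, l1Norm (v i : Fin D → ℝ) ≤ 1 := fun i => hv i (Set.mem_univ i)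
  have hpos : 0 < |e.det v| := by
    have he : ∀ i, (e i : Fin D → ℝ) ≠ 0 := fun i => by
      simpa using e.ne_zero i
    have hu : (fun i => (l1Norm (e i : Fin D → ℝ))⁻¹ • e i) ∈ Set.univ.pi fun _ : Fin k => K := by
      intro i _
      change l1Norm ((l1Norm (e i : Fin D → ℝ))⁻¹ • (e i : Fin D → ℝ)) ≤ 1
      rw [l1Norm_smul, abs_of_pos (inv_pos.2 (l1Norm_pos (he i))),
        inv_mul_cancel₀ (l1Norm_pos (he i)).ne']
    refine lt_of_lt_of_le ?_ (hmax hu)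
    change 0 < |e.det fun i => (l1Norm (e i : Fin D → ℝ))⁻¹ • e i|
    rw [AlternatingMap.map_smul_univ, e.det_self, smul_eq_mul, mul_one, abs_pos,
      Finset.prod_ne_zero_iff]
    exact fun i _ => (inv_pos.2 (l1Norm_pos (he i))).ne'
  have hne : e.det v ≠ 0 := abs_pos.1 hpos
  obtain ⟨hli, hsp⟩ := (e.is_basis_iff_det).2 (isUnit_iff_ne_zero.2 hne)
  refine ⟨Module.Basis.mk hli hsp.ge, fun i => by simpa using hvK i, fun w i => ?_⟩
  rcases eq_or_ne (w : Fin D → ℝ) 0 with hw | hw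
  · have : w = 0 := by simpa using hw
    subst this
    rw [map_zero]
    simp [l1Norm_zero]
  have hwp := l1Norm_pos hw
  set u : W := (l1Norm (w : Fin D → ℝ))⁻¹ • w with hu
  have hwu : w = l1Norm (w : Fin D → ℝ) • u := by
    rw [hu, smul_smul, mul_inv_cancel₀ hwp.ne', one_smul]
  have huK : u ∈ K := by
    change l1Norm ((l1Norm (w : Fin D → ℝ))⁻¹ • (w : Fin D → ℝ)) ≤ 1
    rw [l1Norm_smul, abs_of_pos (inv_pos.2 hwp), inv_mul_cancel₀ hwp.ne']
  -- Cramer's rule: a coordinate of `u` is a ratio of determinants, at most `1` in absolute value by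
  -- maximality.
  have h1 : e.det v * (Module.Basis.mk hli hsp.ge).repr u i = e.det (Function.update v i u) := by
    have := LinearMap.congr_fun (e.det_smul_mk_coord_eq_det_update hli hsp.ge i) u
    simpa using this
  have h2 : |e.det (Function.update v i u)| ≤ |e.det v| := by
    refine hmax fun j _ => ?_
    rcases eq_or_ne j i with rfl | hj
    · simpa using huK
    · rw [Function.update_of_ne hj]
      exact hvK j
  rw [← h1, abs_mul] at h2
  have h3 : |(Module.Basis.mk hli hsp.ge).repr u i| ≤ 1 := by
    by_contra! hc
    nlinarith
  have h4 : (Module.Basis.mk hli hsp.ge).repr w i =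
      l1Norm (w : Fin D → ℝ) * (Module.Basis.mk hli hsp.ge).repr u i := by
    conv_lhs => rw [hwu]
    simp
  rw [h4, abs_mul, abs_of_pos hwp]
  nlinarith

/-- The vector with coordinates `(cᵢ - N) / N` in the family `b`. -/
noncomputable def gridVec {D k : ℕ} (b : Fin k → Fin D → ℝ) (N : ℕ) (c : Fin k → Fin (2 * N + 1)) :
    Fin D → ℝ :=
  ∑ i, ((((c i : ℕ) : ℝ) - N) / N) • b i

lemma exists_grid_near {N : ℕ} (hN : 0 < N) {x : ℝ} (hx : |x| ≤ 1) :
    ∃ c : Fin (2 * N + 1), |x - (((c : ℕ) : ℝ) - N) / N| ≤ 1 / N := by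
  have hN' : (0 : ℝ) < N := by exact_mod_cast hN
  obtain ⟨h1, h2⟩ := abs_le.1 hx
  have h0 : 0 ≤ (x + 1) * N := by nlinarith
  have hle : ⌊(x + 1) * N⌋₊ < 2 * N + 1 := by
    rw [Nat.floor_lt h0]
    push_cast
    nlinarith
  refine ⟨⟨⌊(x + 1) * N⌋₊, hle⟩, ?_⟩
  have h3 := Nat.floor_le h0
  have h4 := Nat.lt_floor_add_one ((x + 1) * N)
  have h5 : x - (((⌊(x + 1) * N⌋₊ : ℕ) : ℝ) - N) / N = ((x + 1) * N - ⌊(x + 1) * N⌋₊) / N := by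
    field_simp; ring
  rw [h5, abs_div, abs_of_pos hN', abs_of_nonneg (by linarith)]
  gcongr
  linarith

/-- A linear map that is bounded on a basis and bounded below on a grid is bounded below. -/
lemma mul_l1Norm_le_of_grid {D d k N : ℕ} {W : Submodule ℝ (Fin D → ℝ)}
    (b : Module.Basis (Fin k) ℝ W) (hb : ∀ i, l1Norm (b i : Fin D → ℝ) ≤ 1)
    (hrepr : ∀ (w : W) i, |b.repr w i| ≤ l1Norm (w : Fin D → ℝ)) (hN : 0 < N)
    (A : Matrix (Fin d) (Fin D) ℝ) {s B : ℝ} (hs : 0 ≤ s)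
    (hB : ∀ i, l1Norm (A.mulVec (b i)) ≤ B)
    (hgrid : ∀ c : Fin k → Fin (2 * N + 1),
      s * l1Norm (gridVec (fun i => (b i : Fin D → ℝ)) N c) ≤
        l1Norm (A.mulVec (gridVec (fun i => (b i : Fin D → ℝ)) N c)))
    {w : Fin D → ℝ} (hw : w ∈ W) :
    (s * (1 - k / N) - k * B / N) * l1Norm w ≤ l1Norm (A.mulVec w) := by
  have hN' : (0 : ℝ) < N := by exact_mod_cast hN
  rcases eq_or_ne w 0 with rfl | hw0
  · simp [l1Norm_zero]
  have key : ∀ u : W, l1Norm (u : Fin D → ℝ) = 1 →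
      s * (1 - k / N) - k * B / N ≤ l1Norm (A.mulVec u) := by
    intro u hu
    have hc : ∀ i, ∃ c : Fin (2 * N + 1), |b.repr u i - (((c : ℕ) : ℝ) - N) / N| ≤ 1 / N :=
      fun i => exists_grid_near hN ((hrepr u i).trans hu.le)
    choose c hc using hc
    set g := gridVec (fun i => (b i : Fin D → ℝ)) N c with hg
    set z : Fin k → ℝ := fun i => b.repr u i - (((c i : ℕ) : ℝ) - N) / N with hz
    have hsum : (u : Fin D → ℝ) = ∑ i, b.repr u i • (b i : Fin D → ℝ) := by
      have := congrArg (Submodule.subtype W) (b.sum_repr u)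
      rw [map_sum] at this
      exact this.symm
    have hdiff : (u : Fin D → ℝ) = g + ∑ i, z i • (b i : Fin D → ℝ) := by
      rw [hsum, hg, gridVec, ← Finset.sum_add_distrib]
      refine Finset.sum_congr rfl fun i _ => ?_
      rw [← add_smul, hz]
      congr 1
      ring
    -- Rounding costs twice: the grid point may be shorter than `u` by `k / N`, and its image may
    -- differ from that of `u` by `k * B / N`.
    have hgn : 1 - k / N ≤ l1Norm g := by
      have h1 : l1Norm (∑ i, z i • (b i : Fin D → ℝ)) ≤ k / N := by
        refine (l1Norm_sum_le _ _).trans ?_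
        calc ∑ i, l1Norm (z i • (b i : Fin D → ℝ)) ≤ ∑ _i : Fin k, (1 / N : ℝ) := by
              refine Finset.sum_le_sum fun i _ => ?_
              rw [l1Norm_smul]
              calc |z i| * l1Norm (b i : Fin D → ℝ) ≤ 1 / N * 1 := by
                    exact mul_le_mul (hc i) (hb i) (l1Norm_nonneg _) (by positivity)
                _ = _ := mul_one _
          _ = k / N := by simp [div_eq_mul_inv]
      have h2 := l1Norm_add_le g (∑ i, z i • (b i : Fin D → ℝ))
      rw [← hdiff, hu] at h2
      linarith
    have hgA : l1Norm (A.mulVec g) ≤ l1Norm (A.mulVec u) + k * B / N := by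
      have h1 : A.mulVec g = A.mulVec u + ∑ i, (-z i) • A.mulVec (b i : Fin D → ℝ) := by
        rw [hdiff, Matrix.mulVec_add, Matrix.mulVec_sum]
        simp [Matrix.mulVec_smul]
      rw [h1]
      refine (l1Norm_add_le _ _).trans (add_le_add le_rfl ?_)
      refine (l1Norm_sum_le _ _).trans ?_
      calc ∑ i, l1Norm ((-z i) • A.mulVec (b i : Fin D → ℝ)) ≤ ∑ _i : Fin k, (1 / N * B : ℝ) := by
            refine Finset.sum_le_sum fun i _ => ?_
            rw [l1Norm_smul, abs_neg]
            have := l1Norm_nonneg (A.mulVec (b i : Fin D → ℝ))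
            gcongr
            · exact hc i
            · exact hB i
        _ = k * B / N := by simp; ring
    have h3 := mul_le_mul_of_nonneg_left hgn hs
    linarith [hgrid c]
  have hwp := l1Norm_pos hw0
  have h := key ((l1Norm w)⁻¹ • ⟨w, hw⟩) (by
    change l1Norm ((l1Norm w)⁻¹ • w) = 1
    rw [l1Norm_smul, abs_of_pos (inv_pos.2 hwp), inv_mul_cancel₀ hwp.ne'])
  change _ ≤ l1Norm (A.mulVec ((l1Norm w)⁻¹ • w)) at h
  rw [Matrix.mulVec_smul, l1Norm_smul, abs_of_pos (inv_pos.2 hwp), le_inv_mul_iff₀ hwp] at h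
  linarith

/-- With large probability, a Cauchy matrix is bounded below on each of finitely many
subspaces of `ℓ¹` of a given dimension. -/
lemma exists_event_mul_l1Norm_le {D d k N : ℕ} {J : Type*} [Fintype J]
    (W : J → Submodule ℝ (Fin D → ℝ)) (hW : ∀ j, Module.finrank ℝ (W j) = k) (hN : 0 < N)
    {s B M : ℝ} (hs : 0 ≤ s) (hB : 0 < B) (hM : 0 < M) :
    ∃ G : Set (Fin d → Fin D → ℝ), MeasurableSet G ∧
      (cauchyMatrix d D).real Gᶜ ≤ Fintype.card J * (k * (d ^ 2 / B)) + Fintype.card J *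
        ((2 * N + 1) ^ k *
          Real.exp (d * ((-(Real.log (1 + M ^ 2) / Real.pi) + 1) / M) + s / M)) ∧
      ∀ A ∈ G, ∀ j, ∀ w ∈ W j,
        (s * (1 - k / N) - k * B / N) * l1Norm w ≤ l1Norm ((Matrix.of A).mulVec w) := by
  choose b hb hrepr using fun j => exists_auerbach_basis (W j) (hW j)
  set g : J → (Fin k → Fin (2 * N + 1)) → Fin D → ℝ :=
    fun j c => gridVec (fun i => (b j i : Fin D → ℝ)) N c with hg
  set E₁ : J → Fin k → Set (Fin d → Fin D → ℝ) := fun j i =>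
    {A | B * l1Norm (b j i : Fin D → ℝ) < l1Norm ((Matrix.of A).mulVec (b j i))} with hE₁
  -- The strict inequality makes the event empty when the grid vector is zero, where the lower tail
  -- bound is unavailable.
  set E₂ : J → (Fin k → Fin (2 * N + 1)) → Set (Fin d → Fin D → ℝ) := fun j c =>
    {A | l1Norm ((Matrix.of A).mulVec (g j c)) < s * l1Norm (g j c)} with hE₂
  have hcont : ∀ x : Fin D → ℝ,
      Continuous fun A : Fin d → Fin D → ℝ => l1Norm ((Matrix.of A).mulVec x) := by
    intro x
    unfold l1Norm Matrix.mulVec dotProduct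
    simp only [Matrix.of_apply]
    fun_prop
  have m₁ : ∀ j i, MeasurableSet (E₁ j i) := fun j i =>
    (isOpen_lt continuous_const (hcont _)).measurableSet
  have m₂ : ∀ j c, MeasurableSet (E₂ j c) := fun j c =>
    (isOpen_lt (hcont _) continuous_const).measurableSet
  set F : Set (Fin d → Fin D → ℝ) := (⋃ j, ⋃ i, E₁ j i) ∪ ⋃ j, ⋃ c, E₂ j c with hF
  refine ⟨Fᶜ, ?_, ?_, ?_⟩
  · exact ((MeasurableSet.iUnion fun j => MeasurableSet.iUnion fun i => m₁ j i).union
      (MeasurableSet.iUnion fun j => MeasurableSet.iUnion fun c => m₂ j c)).compl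
  · rw [compl_compl]
    refine (measureReal_union_le _ _).trans (add_le_add ?_ ?_)
    · refine (measureReal_iUnion_fintype_le _).trans ?_
      have : ∀ j, (cauchyMatrix d D).real (⋃ i, E₁ j i) ≤ k * (d ^ 2 / B) := by
        intro j
        refine (measureReal_iUnion_fintype_le _).trans ?_
        refine (Finset.sum_le_sum fun i _ => cauchyMatrix_upper_tail_crude _ hB).trans ?_
        simp
      refine (Finset.sum_le_sum fun j _ => this j).trans ?_
      simp
    · refine (measureReal_iUnion_fintype_le _).trans ?_
      have h1 : ∀ j c, (cauchyMatrix d D).real (E₂ j c) ≤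
          Real.exp (d * ((-(Real.log (1 + M ^ 2) / Real.pi) + 1) / M) + s / M) := by
        intro j c
        rcases eq_or_ne (g j c) 0 with h0 | h0
        · simp only [hE₂, h0, Matrix.mulVec_zero, l1Norm_zero, mul_zero, lt_irrefl,
            Set.ofPred_false, measureReal_empty]
          positivity
        · refine (measureReal_mono fun A hA => ?_).trans (cauchyMatrix_lower_tail h0 hM s)
          have hA : l1Norm ((Matrix.of A).mulVec (g j c)) < s * l1Norm (g j c) := hA
          exact hA.le
      have : ∀ j, (cauchyMatrix d D).real (⋃ c, E₂ j c) ≤ (2 * N + 1) ^ k *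
          Real.exp (d * ((-(Real.log (1 + M ^ 2) / Real.pi) + 1) / M) + s / M) := by
        intro j
        refine (measureReal_iUnion_fintype_le _).trans ?_
        refine (Finset.sum_le_sum fun c _ => h1 j c).trans ?_
        simp
      refine (Finset.sum_le_sum fun j _ => this j).trans ?_
      simp
  · intro A hA j w hw
    simp only [hF, Set.mem_compl_iff, Set.mem_union, Set.mem_iUnion, not_or, not_exists] at hA
    obtain ⟨hA1, hA2⟩ := hA
    refine mul_l1Norm_le_of_grid (b j) (hb j) (hrepr j) hN (Matrix.of A) hs (fun i => ?_)
      (fun c => ?_) hw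
    · have h1 : l1Norm ((Matrix.of A).mulVec (b j i)) ≤ B * l1Norm (b j i : Fin D → ℝ) :=
        not_lt.1 (hA1 j i)
      nlinarith [hb j i]
    · exact not_lt.1 (hA2 j c)

/-! ### Survival of the nearest subspace -/

lemma l1Dist_le {m : ℕ} (q : Fin m → ℝ) (S : Submodule ℝ (Fin m → ℝ)) {v : Fin m → ℝ}
    (hv : v ∈ S) : l1Dist q S ≤ l1Norm (q - v) :=
  ciInf_le (f := fun v : S => ∑ j, |q j - (v : Fin m → ℝ) j|)
    ⟨0, by rintro _ ⟨v, rfl⟩; exact Finset.sum_nonneg fun _ _ => abs_nonneg _⟩ ⟨v, hv⟩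

lemma le_l1Dist {m : ℕ} (q : Fin m → ℝ) (S : Submodule ℝ (Fin m → ℝ)) {a : ℝ}
    (h : ∀ v ∈ S, a ≤ l1Norm (q - v)) : a ≤ l1Dist q S :=
  le_ciInf fun v : S => h v v.2

lemma exists_l1Norm_sub_lt {m : ℕ} (q : Fin m → ℝ) (S : Submodule ℝ (Fin m → ℝ)) {a : ℝ}
    (h : l1Dist q S < a) : ∃ v ∈ S, l1Norm (q - v) < a := by
  obtain ⟨v, hv⟩ := exists_lt_of_ciInf_lt h
  exact ⟨v, v.2, hv⟩

lemma notMem_of_l1Dist_pos {m : ℕ} {q : Fin m → ℝ} {S : Submodule ℝ (Fin m → ℝ)}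
    (h : 0 < l1Dist q S) : q ∉ S := fun hq => by
  have := l1Dist_le q S hq
  rw [sub_self, l1Norm_zero] at this
  linarith

/-- A Cauchy projection keeps the nearest subspace with probability at least `1/2`, provided
the parameters of the tail bounds are compatible. -/
lemma half_le_measureReal_nearest {n r d N : ℕ} {η U s M T B : ℝ} (hη : 0 < η) (hN : 0 < N)
    (hU : 0 < U) (hs : 0 ≤ s) (hM : 0 < M) (hT : 0 < T) (hB : 0 < B)
    (hupper : d / T + Real.exp (d * ((Real.log (1 + T ^ 2) / Real.pi + 1) / T) - U / T) ≤ 1 / 4)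
    (hcrude : n * ((r + 1 : ℕ) * (d ^ 2 / B)) ≤ 1 / 8)
    (hlower : n * ((2 * N + 1) ^ (r + 1) *
      Real.exp (d * ((-(Real.log (1 + M ^ 2) / Real.pi) + 1) / M) + s / M)) ≤ 1 / 8)
    (hgap : U / η < s * (1 - (r + 1 : ℕ) / N) - (r + 1 : ℕ) * B / N)
    {D : ℕ} (S : Fin n → Submodule ℝ (Fin D → ℝ)) (q : Fin D → ℝ) (i₀ : Fin n)
    (hS : ∀ i, Module.finrank ℝ (S i) = r)
    (hq : ∀ i, i ≠ i₀ → 0 < l1Dist q (S i) ∧ l1Dist q (S i₀) ≤ l1Dist q (S i) / η)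
    {Ω : Type*} [MeasurableSpace Ω] (μ : Measure Ω) [IsProbabilityMeasure μ]
    (P : Ω → Matrix (Fin d) (Fin D) ℝ) (hP : IsIIDCauchy P μ) :
    1 / 2 ≤ μ.real {ω | ∀ i, i ≠ i₀ → l1Dist ((P ω).mulVec q) ((S i₀).map (P ω).mulVecLin) <
      l1Dist ((P ω).mulVec q) ((S i).map (P ω).mulVecLin)} := by
  set V : ℝ := s * (1 - (r + 1 : ℕ) / N) - (r + 1 : ℕ) * B / N with hV
  have hVpos : 0 < V := lt_trans (by positivity) hgap
  -- A near-minimiser suffices: the strict gap `U / η < V` leaves room, so attainment of the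
  -- distance is not needed. Testing against the closest competitor handles all of them with a
  -- single `v₀`.
  have hv₀ : ∃ v ∈ S i₀, ∀ i, i ≠ i₀ → U * l1Norm (q - v) < V * l1Dist q (S i) := by
    rcases isEmpty_or_nonempty {i : Fin n // i ≠ i₀} with he | hne
    · exact ⟨0, zero_mem _, fun i hi => (he.false ⟨i, hi⟩).elim⟩
    · obtain ⟨⟨i, hi⟩, hmin⟩ := Finite.exists_min fun i : {i : Fin n // i ≠ i₀} => l1Dist q (S i)
      have h1 : l1Dist q (S i₀) < V * l1Dist q (S i) / U := by
        rw [lt_div_iff₀ hU]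
        calc _ ≤ l1Dist q (S i) / η * U := by gcongr; exact (hq i hi).2
          _ = U / η * l1Dist q (S i) := by ring
          _ < _ := by
            have := (hq i hi).1
            gcongr
      obtain ⟨v, hv, hlt⟩ := exists_l1Norm_sub_lt q _ h1
      refine ⟨v, hv, fun i' hi' => ?_⟩
      rw [lt_div_iff₀ hU] at hlt
      have h2 : l1Dist q (S i) ≤ l1Dist q (S i') := hmin ⟨i', hi'⟩
      nlinarith
  obtain ⟨v₀, hv₀S, hv₀⟩ := hv₀
  -- Adjoining `q` puts all differences `q - v` with `v ∈ S i` in one linear space; positivity of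
  -- the distance makes its dimension exactly `r + 1`.
  obtain ⟨G, hGm, hGp, hG⟩ := exists_event_mul_l1Norm_le (d := d) (k := r + 1)
    (J := {i : Fin n // i ≠ i₀})
    (fun i => S i ⊔ Submodule.span ℝ {q}) (fun i => by
      rw [Submodule.finrank_sup_span_singleton (notMem_of_l1Dist_pos (hq i i.2).1), hS]) hN hs hB hM
  set F : Set (Fin d → Fin D → ℝ) :=
    {A | U * l1Norm (q - v₀) < l1Norm ((Matrix.of A).mulVec (q - v₀))} with hF
  have hFm : MeasurableSet F := by
    refine (isOpen_lt continuous_const ?_).measurableSet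
    unfold l1Norm Matrix.mulVec dotProduct
    simp only [Matrix.of_apply]
    fun_prop
  have hFp : (cauchyMatrix d D).real F ≤ 1 / 4 := (cauchyMatrix_upper_tail _ hT U).trans hupper
  have hcard : (Fintype.card {i : Fin n // i ≠ i₀} : ℝ) ≤ n := by
    exact_mod_cast (Fintype.card_subtype_le _).trans (Fintype.card_fin n).le
  have hGp' : (cauchyMatrix d D).real Gᶜ ≤ 1 / 4 := by
    refine hGp.trans ?_
    calc _ ≤ n * ((r + 1 : ℕ) * (d ^ 2 / B)) + n * ((2 * N + 1) ^ (r + 1) *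
          Real.exp (d * ((-(Real.log (1 + M ^ 2) / Real.pi) + 1) / M) + s / M)) := by gcongr
      _ ≤ 1 / 8 + 1 / 8 := add_le_add hcrude hlower
      _ = 1 / 4 := by norm_num
  have hgood : 1 / 2 ≤ (cauchyMatrix d D).real (G ∩ Fᶜ) := by
    have h1 := measureReal_union_le (μ := cauchyMatrix d D) Gᶜ F
    have h2 := probReal_add_probReal_compl (μ := cauchyMatrix d D) (hGm.inter hFm.compl)
    rw [Set.compl_inter, compl_compl] at h2
    linarith
  have hlaw := hP.hasLaw_cauchyMatrix
  rw [← hlaw.map_eq, map_measureReal_apply_of_aemeasurable hlaw.aemeasurable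
    (hGm.inter hFm.compl)] at hgood
  refine hgood.trans (measureReal_mono fun ω hω i hi => ?_)
  obtain ⟨hωG, hωF⟩ := hω
  have hG' : ∀ w ∈ S i ⊔ Submodule.span ℝ {q}, V * l1Norm w ≤ l1Norm ((P ω).mulVec w) :=
    hG _ hωG ⟨i, hi⟩
  have hF' : l1Norm ((P ω).mulVec (q - v₀)) ≤ U * l1Norm (q - v₀) := not_lt.1 hωF
  calc l1Dist ((P ω).mulVec q) ((S i₀).map (P ω).mulVecLin)
      ≤ l1Norm ((P ω).mulVec q - (P ω).mulVec v₀) :=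
        l1Dist_le _ _ (Submodule.mem_map.2 ⟨v₀, hv₀S, rfl⟩)
    _ = l1Norm ((P ω).mulVec (q - v₀)) := by rw [Matrix.mulVec_sub]
    _ ≤ U * l1Norm (q - v₀) := hF'
    _ < V * l1Dist q (S i) := hv₀ i hi
    _ ≤ _ := by
      refine le_l1Dist _ _ fun u hu => ?_
      obtain ⟨v, hv, rfl⟩ := Submodule.mem_map.1 hu
      rw [Matrix.mulVecLin_apply, ← Matrix.mulVec_sub]
      refine le_trans ?_ (hG' _ (sub_mem ?_ ?_))
      · gcongr
        exact l1Dist_le q _ hv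
      · exact Submodule.mem_sup_right (Submodule.mem_span_singleton_self q)
      · exact Submodule.mem_sup_left hv

/-! ### Asymptotic choice of parameters -/

open Filter Topology

/-- Truncating at `T = 8 d` makes the first term `1 / 8`, while the exponent behaves like `-(κ - 1)
log d / (4π)`. -/
lemma eventually_upper_tail_le {κ : ℝ} (hκ : 1 < κ) :
    ∀ᶠ d : ℝ in atTop, d / (8 * d) + Real.exp (d * ((Real.log (1 + (8 * d) ^ 2) / Real.pi + 1) /
      (8 * d)) - κ * (2 / Real.pi * (d * Real.log d)) / (8 * d)) ≤ 1 / 4 := by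
  have hpi := Real.pi_pos
  have h1 : ∀ᶠ d : ℝ in atTop, (Real.log 65 + 4 * Real.pi * 8) / (2 * (κ - 1)) ≤ Real.log d :=
    Real.tendsto_log_atTop.eventually_ge_atTop _
  filter_upwards [h1, eventually_ge_atTop 1] with d hd hd1
  have hd0 : 0 < d := by linarith
  rw [div_le_iff₀ (by linarith)] at hd
  have hl : Real.log (1 + (8 * d) ^ 2) ≤ Real.log 65 + 2 * Real.log d := by
    have : Real.log 65 + 2 * Real.log d = Real.log (65 * d ^ 2) := by
      rw [Real.log_mul (by norm_num) (by positivity), Real.log_pow]; norm_num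
    rw [this]
    refine Real.log_le_log (by positivity) ?_
    nlinarith
  have e1 : d / (8 * d) = 1 / 8 := by field_simp
  have e2 : d * ((Real.log (1 + (8 * d) ^ 2) / Real.pi + 1) /
      (8 * d)) - κ * (2 / Real.pi * (d * Real.log d)) / (8 * d) =
      (Real.log (1 + (8 * d) ^ 2) + Real.pi - 2 * κ * Real.log d) / (8 * Real.pi) := by
    field_simp
  have e3 : (Real.log (1 + (8 * d) ^ 2) + Real.pi - 2 * κ * Real.log d) / (8 * Real.pi) ≤ -3 := by
    rw [div_le_iff₀ (by positivity)]
    nlinarith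
  rw [e1, e2]
  have e4 : Real.exp (-3) ≤ 1 / 8 := by
    rw [Real.exp_neg, inv_le_comm₀ (Real.exp_pos _) (by norm_num)]
    have h2 : (2 : ℝ) ≤ Real.exp 1 := by linarith [Real.add_one_le_exp (1 : ℝ)]
    have : Real.exp 3 = Real.exp 1 ^ 3 := by rw [← Real.exp_nat_mul]; norm_num
    rw [this]
    calc _ = (2 : ℝ) ^ 3 := by norm_num
      _ ≤ _ := by gcongr
  have := (Real.exp_le_exp.2 e3).trans e4
  linarith

/-- Truncating at `M = d ^ (1 - α)` retains a fraction `1 - α` of `L` in the mean, and `d / M = d ^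
α` is the resulting Chernoff rate. -/
lemma eventually_lower_tail_exponent_le {α β : ℝ} (hβ : β < 1 - α) :
    ∀ᶠ d : ℝ in atTop, d * ((-(Real.log (1 + (d ^ (1 - α)) ^ 2) / Real.pi) + 1) / d ^ (1 - α)) +
      β * (2 / Real.pi * (d * Real.log d)) / d ^ (1 - α) ≤ -d ^ α := by
  have hpi := Real.pi_pos
  have h1 : ∀ᶠ d : ℝ in atTop, Real.pi / (1 - α - β) ≤ Real.log d :=
    Real.tendsto_log_atTop.eventually_ge_atTop _
  filter_upwards [h1, eventually_ge_atTop 1] with d hd hd1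
  have hd0 : 0 < d := by linarith
  rw [div_le_iff₀ (by linarith)] at hd
  have hdα : 0 < d ^ α := by positivity
  have hM : 0 < d ^ (1 - α) := by positivity
  have e1 : d = d ^ α * d ^ (1 - α) := by
    rw [← Real.rpow_add hd0]; simp
  have e2 : 2 * ((1 - α) * Real.log d) ≤ Real.log (1 + (d ^ (1 - α)) ^ 2) := by
    rw [← Real.log_rpow hd0]
    have : 2 * Real.log (d ^ (1 - α)) = Real.log ((d ^ (1 - α)) ^ 2) := by
      rw [Real.log_pow]; norm_num
    rw [this]
    exact Real.log_le_log (by positivity) (by linarith)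
  set l := Real.log d with hl
  set m := Real.log (1 + (d ^ (1 - α)) ^ 2) with hm
  have e3 : d * ((-(m / Real.pi) + 1) / d ^ (1 - α)) +
      β * (2 / Real.pi * (d * l)) / d ^ (1 - α) =
      d ^ α * ((-m + Real.pi + 2 * β * l) / Real.pi) := by
    have e4 : d / d ^ (1 - α) = d ^ α := by
      rw [div_eq_iff hM.ne']; exact e1
    rw [← e4]
    field_simp
  rw [e3]
  have e5 : (-m + Real.pi + 2 * β * l) / Real.pi ≤ -1 := by
    rw [div_le_iff₀ hpi]
    nlinarith
  nlinarith

/-- The grid size itself depends on `d`, but only polynomially: `log d` is at most `log C + (2 / α)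
log n`. Hence the requirement on `C` is that `(C / 2) ^ α` beat a multiple of `log C`. Since `r > 0`
keeps `r log n` away from `0`, a large `C` also forces `d ≥ d₀`. -/
lemma exists_dimension {α : ℝ} (hα : 0 < α) (A : ℕ) (hA : 0 < A) (d₀ : ℕ) :
    ∃ C : ℝ, 0 < C ∧ ∀ n r : ℕ, 0 < r → r < n →
      ∃ d : ℕ, (d : ℝ) ≤ C * ((r : ℝ) * Real.log n) ^ (1 / α) ∧ d₀ ≤ d ∧ 0 < d ∧
        (n : ℝ) * ((2 * (A * n * (r + 1) ^ 2 * d ^ 2 : ℕ) + 1) ^ (r + 1) * Real.exp (-(d : ℝ) ^ α))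
          ≤ 1 / 8 := by
  have hA' : (1 : ℝ) ≤ A := by exact_mod_cast hA
  have hlA : 0 ≤ Real.log (3 * A) := Real.log_nonneg (by linarith)
  have hlog2 : 1 / 2 ≤ Real.log 2 := by linarith [Real.log_two_gt_d9]
  -- The `4` pays for `log n` and `log 8 = 3 log 2`; the factor `2` comes from `r + 1 ≤ 2 r`.
  set K : ℝ := 4 + 2 * (2 * Real.log (3 * A) + 3 + 4 / α) with hK
  have ev1 : ∀ᶠ C : ℝ in atTop, K + 8 * Real.log C ≤ (C / 2) ^ α := by
    have h1 := (isLittleO_log_rpow_atTop hα).def (c := (1 / 2) ^ α / 16) (by positivity)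
    have h2 : ∀ᶠ C : ℝ in atTop, 2 * K / (1 / 2) ^ α ≤ C ^ α :=
      (tendsto_rpow_atTop hα).eventually_ge_atTop _
    filter_upwards [h1, h2, eventually_ge_atTop 1] with C h1 h2 hC
    have e1 : (C / 2) ^ α = C ^ α * (1 / 2) ^ α := by
      rw [← Real.mul_rpow (by linarith) (by norm_num)]; ring_nf
    rw [Real.norm_of_nonneg (Real.log_nonneg hC), Real.norm_of_nonneg (by positivity)] at h1
    rw [div_le_iff₀ (by positivity)] at h2
    rw [e1]
    linarith
  obtain ⟨C, hC1, hCd, hCge⟩ := (ev1.and ((eventually_ge_atTop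
    ((d₀ + 2) / (Real.log 2) ^ (1 / α))).and (eventually_ge_atTop 1))).exists
  have hC0 : 0 < C := by linarith
  have hlC : 0 ≤ Real.log C := Real.log_nonneg hCge
  refine ⟨C, hC0, fun n r hr hrn => ?_⟩
  have hr1 : (1 : ℝ) ≤ r := by exact_mod_cast hr
  have hn2 : (2 : ℝ) ≤ n := by exact_mod_cast (by omega : 2 ≤ n)
  have hn0 : (0 : ℝ) < n := by linarith
  have hrn' : (r : ℝ) + 1 ≤ n := by exact_mod_cast hrn
  set l := Real.log n with hl
  have hl2 : Real.log 2 ≤ l := Real.log_le_log (by norm_num) hn2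
  have hlh : 1 / 2 ≤ l := hlog2.trans hl2
  set x : ℝ := r * l with hx
  have hlx : l ≤ x := by rw [hx]; nlinarith
  have hx0 : 0 < x := by linarith
  have hxn : Real.log x ≤ 2 * l := by
    have h1 : l ≤ n := (Real.log_le_sub_one_of_pos hn0).trans (by linarith)
    have h2 : x ≤ (n : ℝ) ^ 2 := by rw [hx]; nlinarith
    calc Real.log x ≤ Real.log ((n : ℝ) ^ 2) := Real.log_le_log hx0 h2
      _ = 2 * l := by rw [Real.log_pow, hl]; norm_num
  set y : ℝ := C * x ^ (1 / α) with hy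
  have hy2 : (d₀ : ℝ) + 2 ≤ y := by
    rw [div_le_iff₀ (by positivity)] at hCd
    refine hCd.trans ?_
    rw [hy]
    gcongr
    exact hl2.trans hlx
  have hd₀ : (0 : ℝ) ≤ d₀ := Nat.cast_nonneg _
  have hy0 : 0 ≤ y := by linarith
  set d : ℕ := ⌊y⌋₊ with hd
  have hdy : (d : ℝ) ≤ y := Nat.floor_le hy0
  have hyd : y < d + 1 := Nat.lt_floor_add_one y
  have hdd₀ : d₀ ≤ d := by
    have : (d₀ : ℝ) < d := by linarith
    exact_mod_cast this.le
  have hd1 : (1 : ℝ) ≤ d := by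
    have : (0 : ℝ) < d := by linarith
    exact_mod_cast this
  have hd0 : 0 < d := by exact_mod_cast hd1
  refine ⟨d, hdy, hdd₀, hd0, ?_⟩
  have hdα : (C / 2) ^ α * x ≤ (d : ℝ) ^ α := by
    have h1 : C / 2 * x ^ (1 / α) ≤ d := by
      have : C / 2 * x ^ (1 / α) = y / 2 := by rw [hy]; ring
      rw [this]; linarith
    have h2 : (C / 2) ^ α * x = (C / 2 * x ^ (1 / α)) ^ α := by
      rw [Real.mul_rpow (by positivity) (by positivity), ← Real.rpow_mul hx0.le,
        one_div_mul_cancel hα.ne', Real.rpow_one]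
    rw [h2]
    gcongr
  have hlogd : Real.log d ≤ Real.log C + 2 / α * l := by
    calc Real.log d ≤ Real.log y := Real.log_le_log (by linarith) hdy
      _ = Real.log C + 1 / α * Real.log x := by
        rw [hy, Real.log_mul hC0.ne' (by positivity), Real.log_rpow hx0]
      _ ≤ Real.log C + 1 / α * (2 * l) := by gcongr
      _ = _ := by ring
  set N : ℕ := A * n * (r + 1) ^ 2 * d ^ 2 with hN
  have hNc : (N : ℝ) = A * n * (r + 1) ^ 2 * d ^ 2 := by rw [hN]; push_cast; ring
  have hN1 : (1 : ℝ) ≤ N := by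
    have hn : 0 < n := by omega
    have : 0 < N := by positivity
    exact_mod_cast this
  -- The coefficients of `log (3 A)` and `log C` are doubled so that `l ≥ 1 / 2` lets `l` be
  -- factored out.
  have hlogN : Real.log (2 * N + 1) ≤ (2 * Real.log (3 * A) + 3 + 4 * Real.log C + 4 / α) * l := by
    have h1 : Real.log (r + 1) ≤ l := Real.log_le_log (by linarith) hrn'
    calc Real.log (2 * N + 1) ≤ Real.log (3 * A * n * (r + 1) ^ 2 * d ^ 2) := by
          refine Real.log_le_log (by linarith) ?_
          linarith
      _ = Real.log (3 * A) + l + 2 * Real.log (r + 1) + 2 * Real.log d := by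
          have : (r : ℝ) + 1 ≠ 0 := by positivity
          rw [Real.log_mul (by positivity) (by positivity),
            Real.log_mul (by positivity) (by positivity),
            Real.log_mul (by positivity) (by positivity), Real.log_pow, Real.log_pow, hl]
          norm_num
      _ ≤ Real.log (3 * A) + l + 2 * l + 2 * (Real.log C + 2 / α * l) := by gcongr
      _ ≤ _ := by
        have : 4 / α * l = 2 * (2 / α * l) := by ring
        nlinarith
  have hQ : 0 ≤ 2 * Real.log (3 * A) + 3 + 4 * Real.log C + 4 / α := by positivity
  have htot : Real.log n + (r + 1) * Real.log (2 * N + 1) + Real.log 8 ≤ (d : ℝ) ^ α := by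
    have h8 : Real.log 8 = 3 * Real.log 2 := by
      rw [show (8 : ℝ) = 2 ^ 3 by norm_num, Real.log_pow]; norm_num
    have h1 : ((r : ℝ) + 1) * Real.log (2 * N + 1) ≤
        2 * (2 * Real.log (3 * A) + 3 + 4 * Real.log C + 4 / α) * x := by
      calc _ ≤ (2 * r : ℝ) * ((2 * Real.log (3 * A) + 3 + 4 * Real.log C + 4 / α) * l) := by
            have : 0 ≤ Real.log (2 * N + 1) := Real.log_nonneg (by linarith)
            gcongr
            linarith
        _ = _ := by rw [hx]; ring
    have h2 : (K + 8 * Real.log C) * x ≤ (d : ℝ) ^ α :=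
      (mul_le_mul_of_nonneg_right hC1 hx0.le).trans hdα
    rw [hK] at h2
    rw [h8]
    change l + _ + _ ≤ _
    nlinarith
  have hexp : (n : ℝ) * ((2 * N + 1) ^ (r + 1) * Real.exp (-(d : ℝ) ^ α)) =
      Real.exp (Real.log n + (r + 1) * Real.log (2 * N + 1) - (d : ℝ) ^ α) := by
    have h1 : Real.exp (((r + 1 : ℕ) : ℝ) * Real.log (2 * N + 1)) = (2 * N + 1) ^ (r + 1) := by
      rw [Real.exp_nat_mul, Real.exp_log (by positivity)]
    rw [sub_eq_add_neg, Real.exp_add, Real.exp_add, Real.exp_log hn0, ← h1]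
    push_cast
    ring
  rw [hexp, show (1 / 8 : ℝ) = Real.exp (-Real.log 8) by
    rw [Real.exp_neg, Real.exp_log (by norm_num)]; norm_num]
  exact Real.exp_le_exp.2 (by linarith)

/-! ### The main theorem -/

theorem theorem1 :
    ∃ p : ℝ, 0 < p ∧
      ∀ η : ℝ, 1 < η → ∀ α : ℝ, 0 < α → α < 1 - 1 / η →
        ∃ C : ℝ, 0 < C ∧ ∀ (n r : ℕ) (hrn : r < n),
          ∃ d : ℕ, (d : ℝ) ≤ C * ((r : ℝ) * Real.log (n : ℝ)) ^ (1 / α) ∧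
            ∀ (D : ℕ) (S : Fin n → Submodule ℝ (Fin D → ℝ)) (q : Fin D → ℝ),
              (∀ i, Module.finrank ℝ (S i) = r) →
              (∀ i, i ≠ ⟨0, Nat.zero_lt_of_lt hrn⟩ →
                0 < l1Dist q (S i) ∧
                l1Dist q (S ⟨0, Nat.zero_lt_of_lt hrn⟩) ≤ l1Dist q (S i) / η) →
              ∀ (Ω : Type*) [MeasurableSpace Ω] (μ : Measure Ω) [IsProbabilityMeasure μ]
                (P : Ω → Matrix (Fin d) (Fin D) ℝ), IsIIDCauchy P μ →
                p ≤ μ.real {ω | ∀ i, i ≠ ⟨0, Nat.zero_lt_of_lt hrn⟩ →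
                  l1Dist ((P ω).mulVec q)
                      ((S ⟨0, Nat.zero_lt_of_lt hrn⟩).map (P ω).mulVecLin) <
                    l1Dist ((P ω).mulVec q) ((S i).map (P ω).mulVecLin)} := by
  refine ⟨1 / 2, by norm_num, fun η hη α hα hαη => ?_⟩
  have hη0 : 0 < η := by linarith
  -- The lower tail is used at `β₂ L` and the upper one at `κ L` with `κ < β₁ η`; the margin `β₂ -
  -- β₁` absorbs the discretisation error once `A` is large.
  obtain ⟨β₁, hβ₁, hβ₁'⟩ := exists_between (show 1 / η < 1 - α by linarith)
  obtain ⟨β₂, hβ₂, hβ₂'⟩ := exists_between hβ₁'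
  have hηinv : 0 < 1 / η := by positivity
  obtain ⟨κ, hκ, hκ'⟩ := exists_between (show 1 < β₁ * η by rwa [div_lt_iff₀ hη0] at hβ₁)
  obtain ⟨A, hA⟩ := exists_nat_ge ((β₂ + 8) / (β₂ - β₁) + 1)
  have hA8 : 0 < (β₂ + 8) / (β₂ - β₁) := div_pos (by linarith) (by linarith)
  have hA0 : 0 < A := by
    have : (0 : ℝ) < A := by linarith
    exact_mod_cast this
  have hev : ∀ᶠ d : ℝ in atTop, 1 ≤ 2 / Real.pi * (d * Real.log d) := by
    have : Tendsto (fun d : ℝ => 2 / Real.pi * (d * Real.log d)) atTop atTop :=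
      (tendsto_id.atTop_mul_atTop₀ Real.tendsto_log_atTop).const_mul_atTop
        (by have := Real.pi_pos; positivity)
    exact this.eventually_ge_atTop 1
  obtain ⟨d₀, hd₀⟩ := eventually_atTop.1 (tendsto_natCast_atTop_atTop.eventually
    ((eventually_upper_tail_le hκ).and ((eventually_lower_tail_exponent_le hβ₂').and hev)))
  obtain ⟨C, hC, hdim⟩ := exists_dimension hα A hA0 d₀
  refine ⟨C, hC, fun n r hrn => ?_⟩
  rcases Nat.eq_zero_or_pos r with rfl | hr
  -- For `r = 0` the bound forces `d = 0`. All the subspaces are then zero, so a second one would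
  -- contradict `η > 1`; hence `n = 1` and the claim is vacuous.
  · refine ⟨0, by simp [Real.zero_rpow (inv_ne_zero hα.ne')], fun D S q hS hq Ω _ μ _ P _ => ?_⟩
    have hbot : ∀ i, S i = ⊥ := fun i => Submodule.finrank_eq_zero.1 (hS i)
    have hall : ∀ i : Fin n, i = ⟨0, Nat.zero_lt_of_lt hrn⟩ := by
      intro i
      by_contra hi
      obtain ⟨h1, h2⟩ := hq i hi
      rw [hbot ⟨0, _⟩, ← hbot i] at h2
      exact absurd h2 (not_le.2 (div_lt_self h1 hη))
    have : {ω | ∀ i, i ≠ (⟨0, Nat.zero_lt_of_lt hrn⟩ : Fin n) →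
        l1Dist ((P ω).mulVec q) ((S ⟨0, Nat.zero_lt_of_lt hrn⟩).map (P ω).mulVecLin) <
          l1Dist ((P ω).mulVec q) ((S i).map (P ω).mulVecLin)} = Set.univ :=
      Set.eq_univ_of_forall fun ω i hi => (hi (hall i)).elim
    rw [this, probReal_univ]
    norm_num
  obtain ⟨d, hdC, hdd₀, hd0, hlow⟩ := hdim n r hr hrn
  refine ⟨d, hdC, fun D S q hS hq Ω _ μ _ P hP => ?_⟩
  obtain ⟨hup, hexp, hL⟩ := hd₀ d hdd₀
  have hd0' : (0 : ℝ) < d := by exact_mod_cast hd0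
  have hn0 : (0 : ℝ) < n := by exact_mod_cast Nat.zero_lt_of_lt hrn
  have hr0 : (0 : ℝ) < (r + 1 : ℕ) := by exact_mod_cast Nat.succ_pos r
  have hA0' : (0 : ℝ) < A := by exact_mod_cast hA0
  set L : ℝ := 2 / Real.pi * (d * Real.log d) with hLdef
  have hN0 : 0 < A * n * (r + 1) ^ 2 * d ^ 2 := by
    have : 0 < n := Nat.zero_lt_of_lt hrn
    positivity
  -- `B` makes the crude union bound exactly `1 / 8`, and `N` makes `(r + 1) B / N` equal to `8 /
  -- A`, which is at most `8 L / A` since `L ≥ 1`.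
  refine half_le_measureReal_nearest (N := A * n * (r + 1) ^ 2 * d ^ 2) (U := κ * L) (s := β₂ * L)
    (M := (d : ℝ) ^ (1 - α)) (T := 8 * d) (B := 8 * n * (r + 1 : ℕ) * d ^ 2) hη0 hN0
    (by nlinarith) (by nlinarith) (by positivity) (by positivity) (by positivity) hup ?_ ?_ ?_
    S q _ hS hq μ P hP
  · apply le_of_eq
    field_simp
  · refine le_trans ?_ hlow
    gcongr
  · have hNc : ((A * n * (r + 1) ^ 2 * d ^ 2 : ℕ) : ℝ) = A * n * (r + 1 : ℕ) ^ 2 * d ^ 2 := by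
      push_cast; ring
    rw [hNc]
    have e1 : ((r + 1 : ℕ) : ℝ) * (8 * n * (r + 1 : ℕ) * d ^ 2) /
        (A * n * (r + 1 : ℕ) ^ 2 * d ^ 2) = 8 / A := by
      field_simp
    have e2 : ((r + 1 : ℕ) : ℝ) / (A * n * (r + 1 : ℕ) ^ 2 * d ^ 2) ≤ 1 / A := by
      rw [div_le_div_iff₀ (by positivity) hA0', one_mul]
      have h1 : (1 : ℝ) ≤ n * (r + 1 : ℕ) * d ^ 2 := by
        have : 0 < n * (r + 1) * d ^ 2 := by
          have : 0 < n := Nat.zero_lt_of_lt hrn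
          positivity
        exact_mod_cast this
      calc ((r + 1 : ℕ) : ℝ) * A = (r + 1 : ℕ) * A * 1 := by ring
        _ ≤ (r + 1 : ℕ) * A * (n * (r + 1 : ℕ) * d ^ 2) := by gcongr
        _ = _ := by ring
    have e3 : (β₂ + 8) * (1 / A) ≤ β₂ - β₁ := by
      rw [mul_one_div, div_le_iff₀ hA0', mul_comm, ← div_le_iff₀ (by linarith)]
      linarith
    have e4 : κ * L / η < β₁ * L := by
      rw [div_lt_iff₀ hη0]
      nlinarith
    rw [e1]
    refine e4.trans_le ?_
    have hβL : 0 ≤ β₂ * L := by nlinarith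
    have e5 := mul_le_mul_of_nonneg_left e2 hβL
    have e6 : 8 / (A : ℝ) = 8 * (1 / A) := by ring
    have hA1 : 0 < 1 / (A : ℝ) := by positivity
    have e7 := mul_le_mul_of_nonneg_right e3 (zero_le_one.trans hL)
    have e8 := mul_le_mul_of_nonneg_left hL hA1.le
    rw [e6, mul_sub, mul_one]
    linarith
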